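/- **Definitions.** A birestriction monoid is an algebra $(S;\cdot,{}^*,{}^+,1)$ of type $(2,1,1,0)$ such that $(S;\cdot,1)$ is a monoid and the identities $$xx^*=x,\quad x^*y^*=y^*x^*,\quad (xy^*)^*=x^*y^*,\quad x^*y=y(xy)^*,$$ $$x^+x=x,\quad x^+y^+=y^+x^+,\quad (x^+y)^+=x^+y^+,\quad xy^+=(xy)^+x,\quad (x^+)^*=x^+,\quad (x^*)^+=x^*$$ hold. Its projections are the elements $s^*$, $s\in S$; one puts $s\le t$ if $s=et$ for some projection $e$, and $s\mathrel{\sigma}t$ if $es=et$ for some projection $e$. Every inverse monoid is a birestriction monoid with $x^*=x^{-1}x$ and $x^+=xx^{-1}$; it is called $E$-unitary if every element above an idempotent in the natural partial order is an idempotent. A birestriction monoid $S$ that is $Y$-generated via an assignment map $Y\to S$ *admits a geometric model* if there is an injective $(2,1,1,0)$-morphism from $S$ to a $Y$-generated $E$-unitary inverse monoid which commutes with the assignment maps. An $F$-birestriction monoid is a birestriction monoid in which every $\sigma$-class has a maximum element; denote the maximum element of the $\sigma$-class of $s$ by $\mathsf m(s)$. It is left strong if $\mathsf m(s)\mathsf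 m(t)=\mathsf m(s)^+\mathsf m(st)$ for all $s,t$, right strong if $\mathsf m(s)\mathsf m(t)=\mathsf m(st)\mathsf m(t)^*$ for all $s,t$, and strong if it is both left and right strong. For a set $X$ let $\mathsf{FFBR}_{\varnothing}(X)$, $\mathsf{FFBR}_{ls}(X)$, $\mathsf{FFBR}_{rs}(X)$, $\mathsf{FFBR}_{s}(X)$ be the free $X$-generated $F$-birestriction, left strong, right strong and strong $F$-birestriction monoid, respectively, in the signature $(\cdot,{}^*,{}^+,\mathsf m,1)$. Let $\overline{X^+}=\{\overline u: u\in X^+\}$ be a copy of the free semigroup $X^+$, disjoint from $X$. Consider the sets of relations $$N_{\varnothing}=\{x=\overline x\,x^*,\ \overline u\,\overline v=\overline{uv}\,(\overline u\,\overline v)^*\},\quad N_{ls}=\{x=\overline x\,x^*,\ \overline u\,\overline v=\overline u^{+}\,\overline{uv}\},\quad N_{rs}=\{x=\overline x\,x^*,\ \overline u\,\overline v=\overline{uv}\,\overline v^{*}\},$$ where $x$ runs through $X$ and $u,v$ through $X^+$, and $N_s=N_{ls}\cup N_{rs}$. For $i\in\{\varnothing,ls,rs,s\}$ let $\mathcal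 F_i$ be the birestriction monoid, and $\mathcal I_i$ the inverse monoid, generated by $X\cup\overline{X^+}$ subject to the relations $N_i$ (read in $\mathcal I_i$ with $a^*=a^{-1}a$, $a^+=aa^{-1}$). **Theorem.** Let $|X|\ge 2$ and $i\in\{\varnothing,ls,rs,s\}$. Then the $(X\cup\overline{X^+})$-generated birestriction monoid $\mathcal F_i$ does not admit a geometric model, and neither does $\mathsf{FFBR}_i(X)$, considered as an $(X\cup\overline{X^+})$-generated birestriction monoid via $x\mapsto x$, $\overline u\mapsto\mathsf m(u)$. Moreover, the inverse monoid $\mathcal I_i$ is not $E$-unitary. -/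

import Mathlib

universe u v

/-! ### Birestriction monoids -/

/-- Birestriction monoids, as algebras `(S; ·, ^*, ^+, 1)`; `rst x` is `x^*`, `crst x` is `x^+`. -/
class BirestrictionMonoid (S : Type u) extends Monoid S where
  rst : S → S
  crst : S → S
  mul_rst : ∀ x : S, x * rst x = x
  rst_comm : ∀ x y : S, rst x * rst y = rst y * rst x
  rst_mul_rst : ∀ x y : S, rst (x * rst y) = rst x * rst y
  rst_mul : ∀ x y : S, rst x * y = y * rst (x * y)
  crst_mul : ∀ x : S, crst x * x = x
  crst_comm : ∀ x y : S, crst x * crst y = crst y * crst x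
  crst_mul_crst : ∀ x y : S, crst (crst x * y) = crst x * crst y
  mul_crst : ∀ x y : S, x * crst y = crst (x * y) * x
  rst_crst : ∀ x : S, rst (crst x) = crst x
  crst_rst : ∀ x : S, crst (rst x) = rst x

open BirestrictionMonoid (rst crst)

/-- Morphisms of birestriction monoids, i.e. `(2,1,1,0)`-morphisms. -/
structure BRHom (S : Type u) (T : Type v) [BirestrictionMonoid S] [BirestrictionMonoid T]
    extends S →* T where
  map_rst : ∀ x : S, toFun (rst x) = rst (toFun x)
  map_crst : ∀ x : S, toFun (crst x) = crst (toFun x)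

namespace BirestrictionMonoid

variable {S : Type u} [BirestrictionMonoid S]

/-- The projections `P(S) = {s^* : s ∈ S}` (which is also `{s^+ : s ∈ S}`). -/
def IsProjection (e : S) : Prop := ∃ s : S, e = rst s

/-- The natural partial order. -/
def NatLE (s t : S) : Prop := ∃ e : S, IsProjection e ∧ s = e * t

/-- The relation `σ`, the minimum congruence that identifies all the projections. -/
def Sigma (s t : S) : Prop := ∃ e : S, IsProjection e ∧ e * s = e * t

theorem IsProjection.crst_eq {e : S} (h : IsProjection e) : crst e = e := by
  obtain ⟨s, rfl⟩ := h
  exact crst_rst s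

theorem IsProjection.rst_eq {e : S} (h : IsProjection e) : rst e = e := by
  rw [← h.crst_eq, rst_crst]

theorem isProjection_crst (s : S) : IsProjection (crst s) := ⟨crst s, (rst_crst s).symm⟩

theorem isProjection_one : IsProjection (1 : S) := ⟨1, by simpa using (mul_rst (1 : S)).symm⟩

theorem IsProjection.comm {e f : S} (he : IsProjection e) (hf : IsProjection f) :
    e * f = f * e := by
  rw [← he.rst_eq, ← hf.rst_eq, rst_comm]

theorem IsProjection.mul {e f : S} (he : IsProjection e) (hf : IsProjection f) :
    IsProjection (e * f) :=
  ⟨e * f, by conv_rhs => rw [← hf.rst_eq, rst_mul_rst, he.rst_eq, hf.rst_eq]⟩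

theorem NatLE.eq_crst_mul {s t : S} (h : NatLE s t) : s = crst s * t := by
  obtain ⟨e, he, rfl⟩ := h
  have h1 : crst (e * t) = e * crst t := by
    conv_lhs => rw [← he.crst_eq, crst_mul_crst, he.crst_eq]
  rw [h1, mul_assoc, crst_mul]

theorem NatLE.eq_mul_rst {s t : S} (h : NatLE s t) : s = t * rst s := by
  obtain ⟨e, he, rfl⟩ := h
  rw [← rst_mul, he.rst_eq]

theorem natLE_of_eq_mul_rst {s t y : S} (h : s = t * rst y) : NatLE s t := by
  refine ⟨crst s, isProjection_crst s, ?_⟩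
  conv_rhs => rw [h, ← mul_crst, crst_rst]
  exact h

theorem NatLE.antisymm {s t : S} (h : NatLE s t) (h' : NatLE t s) : s = t := by
  have h1 := h.eq_crst_mul
  have h2 := h'.eq_crst_mul
  have h3 : s = crst s * (crst t * s) := by rw [← h2]; exact h1
  rw [← mul_assoc, crst_comm, mul_assoc, crst_mul, ← h2] at h3
  exact h3

theorem sigma_of_natLE {s t : S} (h : NatLE s t) : Sigma s t :=
  ⟨crst s, isProjection_crst s, by rw [crst_mul]; exact h.eq_crst_mul⟩

theorem Sigma.refl (s : S) : Sigma s s := ⟨1, isProjection_one, rfl⟩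

theorem Sigma.symm {s t : S} : Sigma s t → Sigma t s := fun ⟨e, he, h⟩ => ⟨e, he, h.symm⟩

theorem Sigma.trans {s t w : S} : Sigma s t → Sigma t w → Sigma s w := by
  rintro ⟨e, he, h⟩ ⟨f, hf, h'⟩
  refine ⟨e * f, he.mul hf, ?_⟩
  conv_lhs => rw [he.comm hf, mul_assoc, h, ← mul_assoc, ← he.comm hf, mul_assoc, h']
  rw [mul_assoc]

end BirestrictionMonoid

/-! ### Presentations of birestriction monoids -/

/-- Terms over `Y` in the signature `(·, ^*, ^+, 1)`. -/
inductive BRTerm (Y : Type u) : Type u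
  | of : Y → BRTerm Y
  | one : BRTerm Y
  | mul : BRTerm Y → BRTerm Y → BRTerm Y
  | rst : BRTerm Y → BRTerm Y
  | crst : BRTerm Y → BRTerm Y

namespace BRTerm

/-- Equality of terms modulo the identities of birestriction monoids. -/
inductive Rel {Y : Type u} : BRTerm Y → BRTerm Y → Prop
  | refl (a) : Rel a a
  | symm {a b} : Rel a b → Rel b a
  | trans {a b c} : Rel a b → Rel b c → Rel a c
  | mul {a b c d} : Rel a b → Rel c d → Rel (mul a c) (mul b d)
  | rst {a b} : Rel a b → Rel (rst a) (rst b)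
  | crst {a b} : Rel a b → Rel (crst a) (crst b)
  | mul_assoc (a b c) : Rel (.mul (.mul a b) c) (.mul a (.mul b c))
  | one_mul (a) : Rel (.mul .one a) a
  | mul_one (a) : Rel (.mul a .one) a
  | mul_rst (a) : Rel (.mul a (.rst a)) a
  | rst_comm (a b) : Rel (.mul (.rst a) (.rst b)) (.mul (.rst b) (.rst a))
  | rst_mul_rst (a b) : Rel (.rst (.mul a (.rst b))) (.mul (.rst a) (.rst b))
  | rst_mul (a b) : Rel (.mul (.rst a) b) (.mul b (.rst (.mul a b)))
  | crst_mul (a) : Rel (.mul (.crst a) a) a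
  | crst_comm (a b) : Rel (.mul (.crst a) (.crst b)) (.mul (.crst b) (.crst a))
  | crst_mul_crst (a b) : Rel (.crst (.mul (.crst a) b)) (.mul (.crst a) (.crst b))
  | mul_crst (a b) : Rel (.mul a (.crst b)) (.mul (.crst (.mul a b)) a)
  | rst_crst (a) : Rel (.rst (.crst a)) (.crst a)
  | crst_rst (a) : Rel (.crst (.rst a)) (.rst a)

instance setoid (Y : Type u) : Setoid (BRTerm Y) := ⟨Rel, Rel.refl, Rel.symm, Rel.trans⟩

/-- The value of a term under an assignment of the variables. -/
def eval {Y : Type u} {S : Type v} [BirestrictionMonoid S] (f : Y → S) : BRTerm Y → S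
  | of y => f y
  | one => 1
  | mul a b => eval f a * eval f b
  | rst a => BirestrictionMonoid.rst (eval f a)
  | crst a => BirestrictionMonoid.crst (eval f a)

theorem eval_eq {Y : Type u} {S : Type v} [BirestrictionMonoid S] (f : Y → S)
    {a b : BRTerm Y} (h : Rel a b) : eval f a = eval f b := by
  induction h with
  | refl => rfl
  | symm _ ih => exact ih.symm
  | trans _ _ ih ih' => exact ih.trans ih'
  | mul _ _ ih ih' => simp only [eval, ih, ih']
  | rst _ ih => simp only [eval, ih]
  | crst _ ih => simp only [eval, ih]
  | mul_assoc => exact _root_.mul_assoc _ _ _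
  | one_mul => exact _root_.one_mul _
  | mul_one => exact _root_.mul_one _
  | mul_rst => exact BirestrictionMonoid.mul_rst _
  | rst_comm => exact BirestrictionMonoid.rst_comm _ _
  | rst_mul_rst => exact BirestrictionMonoid.rst_mul_rst _ _
  | rst_mul => exact BirestrictionMonoid.rst_mul _ _
  | crst_mul => exact BirestrictionMonoid.crst_mul _
  | crst_comm => exact BirestrictionMonoid.crst_comm _ _
  | crst_mul_crst => exact BirestrictionMonoid.crst_mul_crst _ _
  | mul_crst => exact BirestrictionMonoid.mul_crst _ _
  | rst_crst => exact BirestrictionMonoid.rst_crst _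
  | crst_rst => exact BirestrictionMonoid.crst_rst _

end BRTerm

/-- The free birestriction monoid `FBR(Y)`. -/
def FreeBR (Y : Type u) : Type u := Quotient (BRTerm.setoid Y)

namespace FreeBR

instance (Y : Type u) : BirestrictionMonoid (FreeBR Y) where
  mul := Quotient.map₂ BRTerm.mul fun _ _ h _ _ h' => BRTerm.Rel.mul h h'
  one := Quotient.mk _ BRTerm.one
  rst := Quotient.map BRTerm.rst fun _ _ h => BRTerm.Rel.rst h
  crst := Quotient.map BRTerm.crst fun _ _ h => BRTerm.Rel.crst h
  mul_assoc := by rintro ⟨a⟩ ⟨b⟩ ⟨c⟩; exact Quotient.sound (.mul_assoc a b c)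
  one_mul := by rintro ⟨a⟩; exact Quotient.sound (.one_mul a)
  mul_one := by rintro ⟨a⟩; exact Quotient.sound (.mul_one a)
  mul_rst := by rintro ⟨a⟩; exact Quotient.sound (.mul_rst a)
  rst_comm := by rintro ⟨a⟩ ⟨b⟩; exact Quotient.sound (.rst_comm a b)
  rst_mul_rst := by rintro ⟨a⟩ ⟨b⟩; exact Quotient.sound (.rst_mul_rst a b)
  rst_mul := by rintro ⟨a⟩ ⟨b⟩; exact Quotient.sound (.rst_mul a b)
  crst_mul := by rintro ⟨a⟩; exact Quotient.sound (.crst_mul a)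
  crst_comm := by rintro ⟨a⟩ ⟨b⟩; exact Quotient.sound (.crst_comm a b)
  crst_mul_crst := by rintro ⟨a⟩ ⟨b⟩; exact Quotient.sound (.crst_mul_crst a b)
  mul_crst := by rintro ⟨a⟩ ⟨b⟩; exact Quotient.sound (.mul_crst a b)
  rst_crst := by rintro ⟨a⟩; exact Quotient.sound (.rst_crst a)
  crst_rst := by rintro ⟨a⟩; exact Quotient.sound (.crst_rst a)

/-- The free generators. -/
def of {Y : Type u} (y : Y) : FreeBR Y := Quotient.mk _ (BRTerm.of y)

/-- The morphism from `FBR(Y)` that extends an assignment map. -/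
def lift {Y : Type u} {S : Type v} [BirestrictionMonoid S] (f : Y → S) : BRHom (FreeBR Y) S where
  toFun := Quotient.lift (BRTerm.eval f) fun _ _ h => BRTerm.eval_eq f h
  map_one' := rfl
  map_mul' := by rintro ⟨a⟩ ⟨b⟩; rfl
  map_rst := by rintro ⟨a⟩; rfl
  map_crst := by rintro ⟨a⟩; rfl

end FreeBR

/-- The `(2,1,1,0)`-congruence on `S` generated by `R`. -/
inductive BRCon {S : Type u} [BirestrictionMonoid S] (R : Set (S × S)) : S → S → Prop
  | of {a b} : (a, b) ∈ R → BRCon R a b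
  | refl (a) : BRCon R a a
  | symm {a b} : BRCon R a b → BRCon R b a
  | trans {a b c} : BRCon R a b → BRCon R b c → BRCon R a c
  | mul {a b c d} : BRCon R a b → BRCon R c d → BRCon R (a * c) (b * d)
  | rst {a b} : BRCon R a b → BRCon R (rst a) (rst b)
  | crst {a b} : BRCon R a b → BRCon R (crst a) (crst b)

/-- The setoid of the generated congruence. -/
def BRCon.setoid {S : Type u} [BirestrictionMonoid S] (R : Set (S × S)) : Setoid S :=
  ⟨BRCon R, BRCon.refl, BRCon.symm, BRCon.trans⟩

/-- The birestriction monoid `BRestr⟨Y | R⟩`, where `(a, b) ∈ R` stands for the relation `a = b`. -/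
def BRPresented {Y : Type u} (R : Set (FreeBR Y × FreeBR Y)) : Type u :=
  Quotient (BRCon.setoid R)

namespace BRPresented

variable {Y : Type u} (R : Set (FreeBR Y × FreeBR Y))

instance : BirestrictionMonoid (BRPresented R) where
  mul := Quotient.map₂ (· * ·) fun _ _ h _ _ h' => BRCon.mul h h'
  one := Quotient.mk _ 1
  rst := Quotient.map rst fun _ _ h => BRCon.rst h
  crst := Quotient.map crst fun _ _ h => BRCon.crst h
  mul_assoc := by rintro ⟨a⟩ ⟨b⟩ ⟨c⟩; exact congrArg (Quotient.mk _) (mul_assoc a b c)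
  one_mul := by rintro ⟨a⟩; exact congrArg (Quotient.mk _) (one_mul a)
  mul_one := by rintro ⟨a⟩; exact congrArg (Quotient.mk _) (mul_one a)
  mul_rst := by
    rintro ⟨a⟩; exact congrArg (Quotient.mk _) (BirestrictionMonoid.mul_rst a)
  rst_comm := by
    rintro ⟨a⟩ ⟨b⟩; exact congrArg (Quotient.mk _) (BirestrictionMonoid.rst_comm a b)
  rst_mul_rst := by
    rintro ⟨a⟩ ⟨b⟩; exact congrArg (Quotient.mk _) (BirestrictionMonoid.rst_mul_rst a b)
  rst_mul := by
    rintro ⟨a⟩ ⟨b⟩; exact congrArg (Quotient.mk _) (BirestrictionMonoid.rst_mul a b)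
  crst_mul := by
    rintro ⟨a⟩; exact congrArg (Quotient.mk _) (BirestrictionMonoid.crst_mul a)
  crst_comm := by
    rintro ⟨a⟩ ⟨b⟩; exact congrArg (Quotient.mk _) (BirestrictionMonoid.crst_comm a b)
  crst_mul_crst := by
    rintro ⟨a⟩ ⟨b⟩; exact congrArg (Quotient.mk _) (BirestrictionMonoid.crst_mul_crst a b)
  mul_crst := by
    rintro ⟨a⟩ ⟨b⟩; exact congrArg (Quotient.mk _) (BirestrictionMonoid.mul_crst a b)
  rst_crst := by
    rintro ⟨a⟩; exact congrArg (Quotient.mk _) (BirestrictionMonoid.rst_crst a)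
  crst_rst := by
    rintro ⟨a⟩; exact congrArg (Quotient.mk _) (BirestrictionMonoid.crst_rst a)

/-- The assignment map of `BRestr⟨Y | R⟩`. -/
def of (y : Y) : BRPresented R := Quotient.mk _ (FreeBR.of y)

end BRPresented

/-! ### Inverse monoids -/

/-- Inverse monoids, as algebras `(S; ·, ⁻¹, 1)`, through their usual defining identities. -/
class InverseMonoid (S : Type u) extends Monoid S, Inv S where
  inv_inv : ∀ x : S, x⁻¹⁻¹ = x
  mul_inv_rev : ∀ x y : S, (x * y)⁻¹ = y⁻¹ * x⁻¹
  mul_inv_mul : ∀ x : S, x * x⁻¹ * x = x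
  comm : ∀ x y : S, x * x⁻¹ * (y * y⁻¹) = y * y⁻¹ * (x * x⁻¹)

namespace InverseMonoid

variable {S : Type u} [InverseMonoid S]

theorem inv_mul_inv (x : S) : x⁻¹ * x * x⁻¹ = x⁻¹ := by
  simpa only [inv_inv] using mul_inv_mul x⁻¹

theorem comm_rst (x y : S) : x⁻¹ * x * (y⁻¹ * y) = y⁻¹ * y * (x⁻¹ * x) := by
  simpa only [inv_inv] using comm x⁻¹ y⁻¹

theorem comm_mixed (x y : S) : x⁻¹ * x * (y * y⁻¹) = y * y⁻¹ * (x⁻¹ * x) := by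
  simpa only [inv_inv] using comm x⁻¹ y

/-- Every inverse monoid is a birestriction monoid with `x^* = x⁻¹x` and `x^+ = xx⁻¹`. -/
instance toBirestrictionMonoid : BirestrictionMonoid S where
  rst x := x⁻¹ * x
  crst x := x * x⁻¹
  mul_rst x := by rw [← mul_assoc, mul_inv_mul]
  rst_comm x y := comm_rst x y
  rst_mul_rst x y := by
    calc (x * (y⁻¹ * y))⁻¹ * (x * (y⁻¹ * y))
        = y⁻¹ * y * (x⁻¹ * x) * (y⁻¹ * y) := by simp only [mul_inv_rev, inv_inv, mul_assoc]
      _ = x⁻¹ * x * (y⁻¹ * y * y⁻¹ * y) := by rw [comm_rst y x]; simp only [mul_assoc]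
      _ = x⁻¹ * x * (y⁻¹ * y) := by rw [inv_mul_inv]
  rst_mul x y := by
    calc x⁻¹ * x * y = x⁻¹ * x * (y * y⁻¹ * y) := by rw [mul_inv_mul]
      _ = x⁻¹ * x * (y * y⁻¹) * y := by simp only [mul_assoc]
      _ = y * y⁻¹ * (x⁻¹ * x) * y := by rw [comm_mixed]
      _ = y * ((x * y)⁻¹ * (x * y)) := by simp only [mul_inv_rev, mul_assoc]
  crst_mul x := mul_inv_mul x
  crst_comm x y := comm x y
  crst_mul_crst x y := by
    calc x * x⁻¹ * y * (x * x⁻¹ * y)⁻¹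
        = x * x⁻¹ * (y * y⁻¹ * (x * x⁻¹)) := by simp only [mul_inv_rev, inv_inv, mul_assoc]
      _ = x * x⁻¹ * x * x⁻¹ * (y * y⁻¹) := by rw [comm y x]; simp only [mul_assoc]
      _ = x * x⁻¹ * (y * y⁻¹) := by rw [mul_inv_mul]
  mul_crst x y := by
    calc x * (y * y⁻¹) = x * x⁻¹ * x * (y * y⁻¹) := by rw [mul_inv_mul]
      _ = x * (x⁻¹ * x * (y * y⁻¹)) := by simp only [mul_assoc]
      _ = x * (y * y⁻¹ * (x⁻¹ * x)) := by rw [comm_mixed]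
      _ = x * y * (x * y)⁻¹ * x := by simp only [mul_inv_rev, mul_assoc]
  rst_crst x := by
    calc (x * x⁻¹)⁻¹ * (x * x⁻¹) = x * x⁻¹ * x * x⁻¹ := by
          simp only [mul_inv_rev, inv_inv, mul_assoc]
      _ = x * x⁻¹ := by rw [mul_inv_mul]
  crst_rst x := by
    calc x⁻¹ * x * (x⁻¹ * x)⁻¹ = x⁻¹ * x * x⁻¹ * x := by
          simp only [mul_inv_rev, inv_inv, mul_assoc]
      _ = x⁻¹ * x := by rw [inv_mul_inv]

end InverseMonoid

/-- An inverse monoid is `E`-unitary if every element above an idempotent in the natural partial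
order (`e ≤ s` iff `e = f * s` for some idempotent `f`) is an idempotent. -/
def IsEUnitary (S : Type u) [InverseMonoid S] : Prop :=
  ∀ e s : S, IsIdempotentElem e → (∃ f : S, IsIdempotentElem f ∧ e = f * s) → IsIdempotentElem s

/-- The inverse monoid `S` is `Y`-generated via the assignment map `κ`. -/
def IsInvGenerated {Y : Type u} {S : Type v} [InverseMonoid S] (κ : Y → S) : Prop :=
  ∀ T : Submonoid S, (∀ s ∈ T, s⁻¹ ∈ T) → (∀ y, κ y ∈ T) → T = ⊤

/-- The `Y`-generated birestriction monoid `S`, with assignment map `ι`, admits a geometric model: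
it canonically `(2,1,1,0)`-embeds into a `Y`-generated `E`-unitary inverse monoid. -/
def AdmitsGeometricModel.{w, u', v'} {Y : Type u'} {S : Type v'} [BirestrictionMonoid S]
    (ι : Y → S) : Prop :=
  ∃ (U : Type w) (_ : InverseMonoid U) (κ : Y → U), IsInvGenerated κ ∧ IsEUnitary U ∧
    ∃ f : BRHom S U, (∀ y, f.toFun (ι y) = κ y) ∧ Function.Injective f.toFun

/-! ### Presentations of inverse monoids -/

/-- Terms over `Y` in the signature `(·, ⁻¹, 1)`. -/
inductive InvTerm (Y : Type u) : Type u
  | of : Y → InvTerm Y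
  | one : InvTerm Y
  | mul : InvTerm Y → InvTerm Y → InvTerm Y
  | inv : InvTerm Y → InvTerm Y

/-- Equality of terms modulo the identities of inverse monoids. -/
inductive InvTerm.Rel {Y : Type u} : InvTerm Y → InvTerm Y → Prop
  | refl (a) : Rel a a
  | symm {a b} : Rel a b → Rel b a
  | trans {a b c} : Rel a b → Rel b c → Rel a c
  | mul {a b c d} : Rel a b → Rel c d → Rel (mul a c) (mul b d)
  | inv {a b} : Rel a b → Rel (inv a) (inv b)
  | mul_assoc (a b c) : Rel (.mul (.mul a b) c) (.mul a (.mul b c))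
  | one_mul (a) : Rel (.mul .one a) a
  | mul_one (a) : Rel (.mul a .one) a
  | inv_inv (a) : Rel (.inv (.inv a)) a
  | mul_inv_rev (a b) : Rel (.inv (.mul a b)) (.mul (.inv b) (.inv a))
  | mul_inv_mul (a) : Rel (.mul (.mul a (.inv a)) a) a
  | comm (a b) : Rel (.mul (.mul a (.inv a)) (.mul b (.inv b)))
      (.mul (.mul b (.inv b)) (.mul a (.inv a)))

instance InvTerm.setoid (Y : Type u) : Setoid (InvTerm Y) :=
  ⟨Rel, Rel.refl, Rel.symm, Rel.trans⟩

/-- The free inverse monoid `FI(Y)`. -/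
def FreeInv (Y : Type u) : Type u := Quotient (InvTerm.setoid Y)

namespace FreeInv

instance (Y : Type u) : InverseMonoid (FreeInv Y) where
  mul := Quotient.map₂ InvTerm.mul fun _ _ h _ _ h' => InvTerm.Rel.mul h h'
  one := Quotient.mk _ InvTerm.one
  inv := Quotient.map InvTerm.inv fun _ _ h => InvTerm.Rel.inv h
  mul_assoc := by rintro ⟨a⟩ ⟨b⟩ ⟨c⟩; exact Quotient.sound (.mul_assoc a b c)
  one_mul := by rintro ⟨a⟩; exact Quotient.sound (.one_mul a)
  mul_one := by rintro ⟨a⟩; exact Quotient.sound (.mul_one a)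
  inv_inv := by rintro ⟨a⟩; exact Quotient.sound (.inv_inv a)
  mul_inv_rev := by rintro ⟨a⟩ ⟨b⟩; exact Quotient.sound (.mul_inv_rev a b)
  mul_inv_mul := by rintro ⟨a⟩; exact Quotient.sound (.mul_inv_mul a)
  comm := by rintro ⟨a⟩ ⟨b⟩; exact Quotient.sound (.comm a b)

/-- The free generators. -/
def of {Y : Type u} (y : Y) : FreeInv Y := Quotient.mk _ (InvTerm.of y)

end FreeInv

/-- The `(2,1,0)`-congruence on the inverse monoid `S` generated by `R`. -/
inductive InvCon {S : Type u} [InverseMonoid S] (R : Set (S × S)) : S → S → Prop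
  | of {a b} : (a, b) ∈ R → InvCon R a b
  | refl (a) : InvCon R a a
  | symm {a b} : InvCon R a b → InvCon R b a
  | trans {a b c} : InvCon R a b → InvCon R b c → InvCon R a c
  | mul {a b c d} : InvCon R a b → InvCon R c d → InvCon R (a * c) (b * d)
  | inv {a b} : InvCon R a b → InvCon R a⁻¹ b⁻¹

/-- The setoid of the generated congruence. -/
def InvCon.setoid {S : Type u} [InverseMonoid S] (R : Set (S × S)) : Setoid S :=
  ⟨InvCon R, InvCon.refl, InvCon.symm, InvCon.trans⟩

/-- The inverse monoid `Inv⟨Y | R⟩`, where `(a, b) ∈ R` stands for the relation `a = b`. -/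
def InvPresented {Y : Type u} (R : Set (FreeInv Y × FreeInv Y)) : Type u :=
  Quotient (InvCon.setoid R)

namespace InvPresented

variable {Y : Type u} (R : Set (FreeInv Y × FreeInv Y))

instance : InverseMonoid (InvPresented R) where
  mul := Quotient.map₂ (· * ·) fun _ _ h _ _ h' => InvCon.mul h h'
  one := Quotient.mk _ 1
  inv := Quotient.map (·⁻¹) fun _ _ h => InvCon.inv h
  mul_assoc := by rintro ⟨a⟩ ⟨b⟩ ⟨c⟩; exact congrArg (Quotient.mk _) (mul_assoc a b c)
  one_mul := by rintro ⟨a⟩; exact congrArg (Quotient.mk _) (one_mul a)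
  mul_one := by rintro ⟨a⟩; exact congrArg (Quotient.mk _) (mul_one a)
  inv_inv := by rintro ⟨a⟩; exact congrArg (Quotient.mk _) (InverseMonoid.inv_inv a)
  mul_inv_rev := by
    rintro ⟨a⟩ ⟨b⟩; exact congrArg (Quotient.mk _) (InverseMonoid.mul_inv_rev a b)
  mul_inv_mul := by rintro ⟨a⟩; exact congrArg (Quotient.mk _) (InverseMonoid.mul_inv_mul a)
  comm := by rintro ⟨a⟩ ⟨b⟩; exact congrArg (Quotient.mk _) (InverseMonoid.comm a b)

/-- The assignment map of `Inv⟨Y | R⟩`. -/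
def of (y : Y) : InvPresented R := Quotient.mk _ (FreeInv.of y)

end InvPresented

/-- The canonical morphism `ψ : FBR(Y) → FI(Y)`. -/
def psi (Y : Type u) : BRHom (FreeBR Y) (FreeInv Y) := FreeBR.lift FreeInv.of

/-- The universal inverse monoid `Inv⟨Y | ψ(R)⟩` of `BRestr⟨Y | R⟩`. -/
abbrev UniversalInverse {Y : Type u} (R : Set (FreeBR Y × FreeBR Y)) : Type u :=
  InvPresented (Prod.map (psi Y).toFun (psi Y).toFun '' R)

/-! ### `F`-birestriction monoids and the free ones -/

/-- `F`-birestriction monoids, as algebras `(S; ·, ^*, ^+, mx, 1)`: the element `mx x` is the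
maximum element of the `σ`-class of `x` with respect to the natural partial order. -/
class FBirestrictionMonoid (S : Type u) extends BirestrictionMonoid S where
  mx : S → S
  sigma_mx : ∀ x : S, BirestrictionMonoid.Sigma x (mx x)
  le_mx : ∀ x y : S, BirestrictionMonoid.Sigma x y → BirestrictionMonoid.NatLE y (mx x)

open FBirestrictionMonoid (mx)

/-- Morphisms of `F`-birestriction monoids, i.e. `(2,1,1,1,0)`-morphisms. -/
structure FBRHom (S : Type u) (T : Type v) [FBirestrictionMonoid S] [FBirestrictionMonoid T]
    extends BRHom S T where
  map_mx : ∀ x : S, toFun (mx x) = mx (toFun x)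

/-- The index `i ∈ {∅, ls, rs, s}`. -/
inductive Strength
  | plain
  | ls
  | rs
  | s

/-- The indices of the classes that consist of left strong monoids. -/
def Strength.IsLeft (i : Strength) : Prop := i = .ls ∨ i = .s

/-- The indices of the classes that consist of right strong monoids. -/
def Strength.IsRight (i : Strength) : Prop := i = .rs ∨ i = .s

/-- `S` is an arbitrary, left strong, right strong, strong `F`-birestriction monoid,
for `i = plain, ls, rs, s`: the premorphism `S/σ → S`, `[x] ↦ mx x`, has the respective property. -/
def HasStrength (i : Strength) (S : Type u) [FBirestrictionMonoid S] : Prop :=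
  (i.IsLeft → ∀ x y : S, mx x * mx y = crst (mx x) * mx (x * y)) ∧
  (i.IsRight → ∀ x y : S, mx x * mx y = mx (x * y) * rst (mx y))

namespace FBirestrictionMonoid

variable {S : Type u} [FBirestrictionMonoid S]

theorem mx_mul_rst (x : S) : mx x * rst x = x :=
  ((le_mx x x (BirestrictionMonoid.Sigma.refl x)).eq_mul_rst).symm

theorem mx_eq_of_sigma {x y : S} (h : BirestrictionMonoid.Sigma x y) : mx x = mx y :=
  (le_mx y (mx x) (h.symm.trans (sigma_mx x))).antisymm (le_mx x (mx y) (h.trans (sigma_mx y)))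

theorem mx_mul_rst_right (x y : S) : mx (x * rst y) = mx x :=
  mx_eq_of_sigma (BirestrictionMonoid.sigma_of_natLE
    (BirestrictionMonoid.natLE_of_eq_mul_rst (y := y) rfl))

end FBirestrictionMonoid

/-- Terms over `X` in the signature `(·, ^*, ^+, mx, 1)`. -/
inductive FTerm (X : Type u) : Type u
  | of : X → FTerm X
  | one : FTerm X
  | mul : FTerm X → FTerm X → FTerm X
  | rst : FTerm X → FTerm X
  | crst : FTerm X → FTerm X
  | mx : FTerm X → FTerm X

namespace FTerm

/-- Equality of terms modulo the identities that define the variety of arbitrary, left strong,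
right strong, strong `F`-birestriction monoids, for `i = plain, ls, rs, s`. -/
inductive Rel {X : Type u} (i : Strength) : FTerm X → FTerm X → Prop
  | refl (a) : Rel i a a
  | symm {a b} : Rel i a b → Rel i b a
  | trans {a b c} : Rel i a b → Rel i b c → Rel i a c
  | mul {a b c d} : Rel i a b → Rel i c d → Rel i (mul a c) (mul b d)
  | rst {a b} : Rel i a b → Rel i (rst a) (rst b)
  | crst {a b} : Rel i a b → Rel i (crst a) (crst b)
  | mx {a b} : Rel i a b → Rel i (mx a) (mx b)
  | mul_assoc (a b c) : Rel i (.mul (.mul a b) c) (.mul a (.mul b c))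
  | one_mul (a) : Rel i (.mul .one a) a
  | mul_one (a) : Rel i (.mul a .one) a
  | mul_rst (a) : Rel i (.mul a (.rst a)) a
  | rst_comm (a b) : Rel i (.mul (.rst a) (.rst b)) (.mul (.rst b) (.rst a))
  | rst_mul_rst (a b) : Rel i (.rst (.mul a (.rst b))) (.mul (.rst a) (.rst b))
  | rst_mul (a b) : Rel i (.mul (.rst a) b) (.mul b (.rst (.mul a b)))
  | crst_mul (a) : Rel i (.mul (.crst a) a) a
  | crst_comm (a b) : Rel i (.mul (.crst a) (.crst b)) (.mul (.crst b) (.crst a))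
  | crst_mul_crst (a b) : Rel i (.crst (.mul (.crst a) b)) (.mul (.crst a) (.crst b))
  | mul_crst (a b) : Rel i (.mul a (.crst b)) (.mul (.crst (.mul a b)) a)
  | rst_crst (a) : Rel i (.rst (.crst a)) (.crst a)
  | crst_rst (a) : Rel i (.crst (.rst a)) (.rst a)
  | mx_mul_rst (a) : Rel i (.mul (.mx a) (.rst a)) a
  | mx_mul_rst_right (a b) : Rel i (.mx (.mul a (.rst b))) (.mx a)
  | left (h : i.IsLeft) (a b) :
      Rel i (.mul (.mx a) (.mx b)) (.mul (.crst (.mx a)) (.mx (.mul a b)))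
  | right (h : i.IsRight) (a b) :
      Rel i (.mul (.mx a) (.mx b)) (.mul (.mx (.mul a b)) (.rst (.mx b)))

/-- The setoid of this relation. -/
def setoid (i : Strength) (X : Type u) : Setoid (FTerm X) :=
  ⟨Rel i, Rel.refl, Rel.symm, Rel.trans⟩

/-- The value of a term under an assignment of the variables. -/
def eval {X : Type u} {S : Type v} [FBirestrictionMonoid S] (f : X → S) : FTerm X → S
  | of x => f x
  | one => 1
  | mul a b => eval f a * eval f b
  | rst a => BirestrictionMonoid.rst (eval f a)
  | crst a => BirestrictionMonoid.crst (eval f a)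
  | mx a => FBirestrictionMonoid.mx (eval f a)

theorem eval_eq {X : Type u} {S : Type v} [FBirestrictionMonoid S] {i : Strength}
    (hS : HasStrength i S) (f : X → S) {a b : FTerm X} (h : Rel i a b) :
    eval f a = eval f b := by
  induction h with
  | refl => rfl
  | symm _ ih => exact ih.symm
  | trans _ _ ih ih' => exact ih.trans ih'
  | mul _ _ ih ih' => simp only [eval, ih, ih']
  | rst _ ih => simp only [eval, ih]
  | crst _ ih => simp only [eval, ih]
  | mx _ ih => simp only [eval, ih]
  | mul_assoc => exact _root_.mul_assoc _ _ _
  | one_mul => exact _root_.one_mul _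
  | mul_one => exact _root_.mul_one _
  | mul_rst => exact BirestrictionMonoid.mul_rst _
  | rst_comm => exact BirestrictionMonoid.rst_comm _ _
  | rst_mul_rst => exact BirestrictionMonoid.rst_mul_rst _ _
  | rst_mul => exact BirestrictionMonoid.rst_mul _ _
  | crst_mul => exact BirestrictionMonoid.crst_mul _
  | crst_comm => exact BirestrictionMonoid.crst_comm _ _
  | crst_mul_crst => exact BirestrictionMonoid.crst_mul_crst _ _
  | mul_crst => exact BirestrictionMonoid.mul_crst _ _
  | rst_crst => exact BirestrictionMonoid.rst_crst _
  | crst_rst => exact BirestrictionMonoid.crst_rst _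
  | mx_mul_rst => exact FBirestrictionMonoid.mx_mul_rst _
  | mx_mul_rst_right => exact FBirestrictionMonoid.mx_mul_rst_right _ _
  | left h => exact hS.1 h _ _
  | right h => exact hS.2 h _ _

end FTerm

/-- The free arbitrary, left strong, right strong, strong `F`-birestriction monoid over `X`,
for `i = plain, ls, rs, s`. -/
def FreeFBR (i : Strength) (X : Type u) : Type u := Quotient (FTerm.setoid i X)

namespace FreeFBR

variable (i : Strength) (X : Type u)

instance instBR : BirestrictionMonoid (FreeFBR i X) where
  mul := Quotient.map₂ FTerm.mul fun _ _ h _ _ h' => FTerm.Rel.mul h h'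
  one := Quotient.mk _ FTerm.one
  rst := Quotient.map FTerm.rst fun _ _ h => FTerm.Rel.rst h
  crst := Quotient.map FTerm.crst fun _ _ h => FTerm.Rel.crst h
  mul_assoc := by rintro ⟨a⟩ ⟨b⟩ ⟨c⟩; exact Quotient.sound (.mul_assoc a b c)
  one_mul := by rintro ⟨a⟩; exact Quotient.sound (.one_mul a)
  mul_one := by rintro ⟨a⟩; exact Quotient.sound (.mul_one a)
  mul_rst := by rintro ⟨a⟩; exact Quotient.sound (.mul_rst a)
  rst_comm := by rintro ⟨a⟩ ⟨b⟩; exact Quotient.sound (.rst_comm a b)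
  rst_mul_rst := by rintro ⟨a⟩ ⟨b⟩; exact Quotient.sound (.rst_mul_rst a b)
  rst_mul := by rintro ⟨a⟩ ⟨b⟩; exact Quotient.sound (.rst_mul a b)
  crst_mul := by rintro ⟨a⟩; exact Quotient.sound (.crst_mul a)
  crst_comm := by rintro ⟨a⟩ ⟨b⟩; exact Quotient.sound (.crst_comm a b)
  crst_mul_crst := by rintro ⟨a⟩ ⟨b⟩; exact Quotient.sound (.crst_mul_crst a b)
  mul_crst := by rintro ⟨a⟩ ⟨b⟩; exact Quotient.sound (.mul_crst a b)
  rst_crst := by rintro ⟨a⟩; exact Quotient.sound (.rst_crst a)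
  crst_rst := by rintro ⟨a⟩; exact Quotient.sound (.crst_rst a)

variable {i X}

/-- The operation `mx` induced by the one on terms. -/
def max : FreeFBR i X → FreeFBR i X := Quotient.map FTerm.mx fun _ _ h => FTerm.Rel.mx h

theorem max_mul_rst (x : FreeFBR i X) : max x * rst x = x := by
  obtain ⟨a⟩ := x; exact Quotient.sound (.mx_mul_rst a)

theorem max_mul_rst_right (x y : FreeFBR i X) : max (x * rst y) = max x := by
  obtain ⟨a⟩ := x; obtain ⟨b⟩ := y; exact Quotient.sound (.mx_mul_rst_right a b)

theorem natLE_max (x : FreeFBR i X) : BirestrictionMonoid.NatLE x (max x) :=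
  BirestrictionMonoid.natLE_of_eq_mul_rst (max_mul_rst x).symm

theorem max_mul_left {e : FreeFBR i X} (he : BirestrictionMonoid.IsProjection e)
    (x : FreeFBR i X) : max (e * x) = max x := by
  rw [← he.rst_eq, BirestrictionMonoid.rst_mul, max_mul_rst_right]

instance instFBR : FBirestrictionMonoid (FreeFBR i X) where
  mx := max
  sigma_mx x := BirestrictionMonoid.sigma_of_natLE (natLE_max x)
  le_mx := by
    rintro x y ⟨e, he, h⟩
    rw [← max_mul_left he x, h, max_mul_left he y]
    exact natLE_max y

theorem hasStrength : HasStrength i (FreeFBR i X) := by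
  constructor
  · rintro h ⟨a⟩ ⟨b⟩; exact Quotient.sound (.left h a b)
  · rintro h ⟨a⟩ ⟨b⟩; exact Quotient.sound (.right h a b)

/-- The free generators. -/
def of (x : X) : FreeFBR i X := Quotient.mk _ (FTerm.of x)

/-- The universal property. -/
theorem existsUnique_lift {S : Type v} [FBirestrictionMonoid S] (hS : HasStrength i S)
    (f : X → S) : ∃! g : FBRHom (FreeFBR i X) S, ∀ x, g.toFun (of x) = f x := by
  refine ⟨{ toFun := Quotient.lift (FTerm.eval f) fun _ _ h => FTerm.eval_eq hS f h
            map_one' := rfl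
            map_mul' := by rintro ⟨a⟩ ⟨b⟩; rfl
            map_rst := by rintro ⟨a⟩; rfl
            map_crst := by rintro ⟨a⟩; rfl
            map_mx := by rintro ⟨a⟩; rfl }, fun x => rfl, ?_⟩
  intro g hg
  have key : ∀ a : FTerm X, g.toFun (Quotient.mk (FTerm.setoid i X) a) = FTerm.eval f a := by
    intro a
    induction a with
    | of x => exact hg x
    | one => exact g.map_one'
    | mul a b iha ihb => exact (g.map_mul' _ _).trans (congrArg₂ (· * ·) iha ihb)
    | rst a ih => exact (g.map_rst _).trans (congrArg rst ih)
    | crst a ih => exact (g.map_crst _).trans (congrArg crst ih)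
    | mx a ih => exact (g.map_mx _).trans (congrArg mx ih)
  obtain ⟨⟨⟨⟨g, _⟩, _⟩, _, _⟩, _⟩ := g
  congr 4
  funext x
  obtain ⟨a⟩ := x
  exact key a

end FreeFBR

/-! ### The extended generators, the relations `N_i`, and the monoids `𝓕_i` and `𝓘_i` -/

/-- The extended set of generators `X ∪ X̄⁺`, where `X̄⁺` is a copy of the free semigroup `X⁺`. -/
abbrev ExtGen (X : Type u) : Type u := X ⊕ FreeSemigroup X

section Relations

variable {X : Type u}

/-- The generator `x ∈ X`, as an element of `FBR(X ∪ X̄⁺)`. -/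
def genX (x : X) : FreeBR (ExtGen X) := FreeBR.of (Sum.inl x)

/-- The generator `ū ∈ X̄⁺`, as an element of `FBR(X ∪ X̄⁺)`. -/
def genBar (u : FreeSemigroup X) : FreeBR (ExtGen X) := FreeBR.of (Sum.inr u)

/-- The relations `x̄ ≥ x`, that is, `x = x̄ x^*`. -/
def relX (X : Type u) : Set (FreeBR (ExtGen X) × FreeBR (ExtGen X)) :=
  {p | ∃ x : X, p = (genX x, genBar (FreeSemigroup.of x) * rst (genX x))}

/-- The relations `N`: `x̄ ≥ x` and `(uv)‾ ≥ ū v̄`, that is, `ū v̄ = (uv)‾ (ū v̄)^*`. -/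
def relN (X : Type u) : Set (FreeBR (ExtGen X) × FreeBR (ExtGen X)) :=
  relX X ∪ {p | ∃ u v : FreeSemigroup X,
    p = (genBar u * genBar v, genBar (u * v) * rst (genBar u * genBar v))}

/-- The relations `N_ls`: `x̄ ≥ x` and `ū v̄ = ū^+ (uv)‾`. -/
def relNls (X : Type u) : Set (FreeBR (ExtGen X) × FreeBR (ExtGen X)) :=
  relX X ∪ {p | ∃ u v : FreeSemigroup X,
    p = (genBar u * genBar v, crst (genBar u) * genBar (u * v))}

/-- The relations `N_rs`: `x̄ ≥ x` and `ū v̄ = (uv)‾ v̄^*`. -/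
def relNrs (X : Type u) : Set (FreeBR (ExtGen X) × FreeBR (ExtGen X)) :=
  relX X ∪ {p | ∃ u v : FreeSemigroup X,
    p = (genBar u * genBar v, genBar (u * v) * rst (genBar v))}

end Relations

/-- The relations `N_i`, `i ∈ {∅, ls, rs, s}`. -/
def relOf (X : Type u) : Strength → Set (FreeBR (ExtGen X) × FreeBR (ExtGen X))
  | .plain => relN X
  | .ls => relNls X
  | .rs => relNrs X
  | .s => relNls X ∪ relNrs X

/-- The birestriction monoid `𝓕_i = BRestr⟨X ∪ X̄⁺ | N_i⟩`. -/
abbrev CalF (i : Strength) (X : Type u) : Type u := BRPresented (relOf X i)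

/-- The inverse monoid `𝓘_i = Inv⟨X ∪ X̄⁺ | ψ(N_i)⟩`, the universal inverse monoid of `𝓕_i`. -/
abbrev CalI (i : Strength) (X : Type u) : Type u := UniversalInverse (relOf X i)

/-- The assignment map of `𝓕_i`. -/
def CalF.gen (i : Strength) (X : Type u) : ExtGen X → CalF i X := BRPresented.of (relOf X i)

/-- The assignment map `x ↦ x`, `ū ↦ mx u`, with which the free `F`-birestriction monoid over `X`
is an `(X ∪ X̄⁺)`-generated birestriction monoid. -/
def FreeFBR.gen (i : Strength) (X : Type u) : ExtGen X → FreeFBR i X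
  | Sum.inl x => FreeFBR.of x
  | Sum.inr w => mx (FreeSemigroup.lift (FreeFBR.of : X → FreeFBR i X) w)

/-! All the negative statements come from one zigzag. In an inverse monoid let `p ≥ ab`, `q ≥ cb`,
`r ≥ cd`, `s ≥ ad`. Then `p q⁻¹ r s⁻¹` lies above `ab(cb)⁻¹cd(ad)⁻¹ = a(bb⁻¹)(c⁻¹c)(dd⁻¹)a⁻¹`, which
is idempotent; so `E`-unitarity makes `t = p q⁻¹ r s⁻¹` idempotent (`isIdempotentElem_zigzag`). An
idempotent `t` equals its range projection, and ending in `s⁻¹` it satisfies `t · ss⁻¹ = t`. The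
range projection of `t` can be written without inverses (`zigzagRange`), so `zigzagRange p q r s *
s^+ = zigzagRange p q r s` must hold in every birestriction monoid that admits a geometric model
(`not_admitsGeometricModel`).

It is applied with `a = b = x̄` and `c = d = ȳ`, where `p, q, r, s` are the barred words `xx, yx,
yy, xy`. The identity fails because these four can be sent to partial bijections `1 ↦ 4`, `1 ↦ 3`,
`0 ↦ 3`, `0 ↦ 2`, and all other words of length different from two to the empty map: then `t`
becomes `2 ↦ 4`. Products of two such maps are empty, which makes `sep` both left and right strong,
so a single map serves all four indices.

For the presented monoids this yields a morphism directly. For the free `F`-birestriction monoids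
the target must itself be one; it consists of the pairs `(a, f)` with `f ≤ φ a`, where `φ` is the
premorphism extending `sep`, and the maximum elements are the pairs `(a, φ a)`. -/

open BirestrictionMonoid (IsProjection NatLE Sigma)

/-! ### Natural order and projections -/

namespace BirestrictionMonoid

variable {S : Type u} [BirestrictionMonoid S]

theorem NatLE.mul {a b c d : S} (h : NatLE a b) (h' : NatLE c d) : NatLE (a * c) (b * d) := by
  obtain ⟨e, he, rfl⟩ := h
  obtain ⟨f, hf, rfl⟩ := h'
  -- The projection `f` is carried to the left of `b` by `bf = (bf)^+ b`.
  refine ⟨e * crst (b * f), he.mul (isProjection_crst _), ?_⟩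
  have hbf : b * f = crst (b * f) * b := by
    conv_lhs => rw [← hf.crst_eq, mul_crst]
  calc e * b * (f * d) = e * (b * f) * d := by simp only [mul_assoc]
    _ = e * (crst (b * f) * b) * d := by rw [← hbf]
    _ = e * crst (b * f) * (b * d) := by simp only [mul_assoc]

theorem NatLE.refl (a : S) : NatLE a a := ⟨1, isProjection_one, (one_mul a).symm⟩

theorem rst_one : rst (1 : S) = 1 := isProjection_one.rst_eq

theorem crst_one : crst (1 : S) = 1 := isProjection_one.crst_eq

theorem isProjection_rst (s : S) : IsProjection (rst s) := ⟨s, rfl⟩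

theorem IsProjection.isIdempotentElem {e : S} (he : IsProjection e) : IsIdempotentElem e := by
  have h := crst_mul e
  rwa [he.crst_eq] at h

theorem IsProjection.natLE_one {e : S} (he : IsProjection e) : NatLE e 1 :=
  ⟨e, he, (mul_one e).symm⟩

end BirestrictionMonoid

/-- In an inverse monoid this is the range of `p q⁻¹ r s⁻¹`. -/
def zigzagRange {S : Type u} [BirestrictionMonoid S] (p q r s : S) : S :=
  crst (p * rst (crst (r * rst s) * q))

theorem BRHom.map_mul_toFun {S : Type u} {T : Type v} [BirestrictionMonoid S] [BirestrictionMonoid T]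
    (f : BRHom S T) (a b : S) : f.toFun (a * b) = f.toFun a * f.toFun b :=
  f.toMonoidHom.map_mul a b

theorem BRHom.map_zigzagRange {S : Type u} {T : Type v} [BirestrictionMonoid S]
    [BirestrictionMonoid T] (f : BRHom S T) (p q r s : S) :
    f.toFun (zigzagRange p q r s) =
      zigzagRange (f.toFun p) (f.toFun q) (f.toFun r) (f.toFun s) := by
  simp only [zigzagRange, f.map_crst, f.map_mul_toFun, f.map_rst]

theorem BRHom.map_natLE {S : Type u} {T : Type v} [BirestrictionMonoid S]
    [BirestrictionMonoid T] (f : BRHom S T) {a b : S} (h : NatLE a b) :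
    NatLE (f.toFun a) (f.toFun b) := by
  obtain ⟨e, ⟨z, rfl⟩, rfl⟩ := h
  exact ⟨_, ⟨f.toFun z, f.map_rst z⟩, f.map_mul_toFun _ _⟩

/-! ### The zigzag in inverse monoids -/

namespace InverseMonoid

variable {S : Type u} [InverseMonoid S]

theorem rst_def (a : S) : rst a = a⁻¹ * a := rfl

theorem crst_def (a : S) : crst a = a * a⁻¹ := rfl

theorem inv_rst (a : S) : (rst a)⁻¹ = rst a := by
  simp only [rst_def, mul_inv_rev, inv_inv]

/-- The range of `b⁻¹` is `b^*`, and the range of a product depends on its right factor only through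
the range of that factor. This and its dual eliminate inverses from `zigzagRange`. -/
theorem crst_mul_rst_eq (p b : S) : crst (p * rst b) = crst (p * b⁻¹) := by
  calc p * (b⁻¹ * b) * (p * (b⁻¹ * b))⁻¹ = p * (b⁻¹ * b * b⁻¹) * b * p⁻¹ := by
        simp only [mul_inv_rev, inv_inv, mul_assoc]
    _ = p * b⁻¹ * (p * b⁻¹)⁻¹ := by
        rw [inv_mul_inv]; simp only [mul_inv_rev, inv_inv, mul_assoc]

theorem rst_crst_mul_eq (a q : S) : rst (crst a * q) = rst (a⁻¹ * q) := by
  calc (a * a⁻¹ * q)⁻¹ * (a * a⁻¹ * q) = q⁻¹ * (a * a⁻¹ * a) * a⁻¹ * q := by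
        simp only [mul_inv_rev, inv_inv, mul_assoc]
    _ = (a⁻¹ * q)⁻¹ * (a⁻¹ * q) := by
        rw [mul_inv_mul]; simp only [mul_inv_rev, inv_inv, mul_assoc]

theorem zigzagRange_eq (p q r s : S) : zigzagRange p q r s = crst (p * q⁻¹ * r * s⁻¹) := by
  rw [zigzagRange, crst_mul_rst_eq r s, rst_crst_mul_eq, crst_mul_rst_eq]
  simp only [mul_inv_rev, inv_inv, mul_assoc]

/-- With `t` also `t⁻¹` is idempotent, so commuting `t⁻¹t` past `tt⁻¹` turns `t⁻¹ = (t⁻¹t)(tt⁻¹)`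
into `t t⁻¹ t = t`. -/
theorem inv_eq_self {t : S} (h : IsIdempotentElem t) : t⁻¹ = t := by
  have h' : t⁻¹ * t⁻¹ = t⁻¹ := by rw [← mul_inv_rev, h.eq]
  calc t⁻¹ = t⁻¹ * t * t⁻¹ := (inv_mul_inv t).symm
    _ = t⁻¹ * (t * t) * t⁻¹ := by rw [h.eq]
    _ = t⁻¹ * t * (t * t⁻¹) := by simp only [mul_assoc]
    _ = t * (t⁻¹ * t⁻¹) * t := by rw [comm_mixed]; simp only [mul_assoc]
    _ = t := by rw [h', mul_inv_mul]

theorem crst_eq_self {t : S} (h : IsIdempotentElem t) : crst t = t := by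
  rw [crst_def, inv_eq_self h, h.eq]

theorem natLE_inv {a b : S} (h : NatLE a b) : NatLE a⁻¹ b⁻¹ := by
  obtain ⟨e, ⟨z, rfl⟩, rfl⟩ := h
  exact BirestrictionMonoid.natLE_of_eq_mul_rst (y := z) (by rw [mul_inv_rev, inv_rst])

theorem crst_mul_of_isProjection (a : S) {e : S} (he : IsProjection e) :
    crst (a * e) = a * e * a⁻¹ := by
  calc a * e * (a * e)⁻¹ = a * (e * e) * a⁻¹ := by
        rw [mul_inv_rev, inv_eq_self he.isIdempotentElem]; simp only [mul_assoc]
    _ = a * e * a⁻¹ := by rw [he.isIdempotentElem.eq]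

/-- The crucial consequence of `E`-unitarity: `p q⁻¹ r s⁻¹` is idempotent as soon as `p`, `q`, `r`
and `s` are above `ab`, `cb`, `cd` and `ad`. -/
theorem isIdempotentElem_zigzag (hS : IsEUnitary S) {a b c d p q r s : S} (hp : NatLE (a * b) p)
    (hq : NatLE (c * b) q) (hr : NatLE (c * d) r) (hs : NatLE (a * d) s) :
    IsIdempotentElem (p * q⁻¹ * r * s⁻¹) := by
  -- Products and inverses preserve the order, so the zigzag of the lower bounds lies below that of
  -- `p, q, r, s`.
  obtain ⟨f, hf, h⟩ := ((hp.mul (natLE_inv hq)).mul hr).mul (natLE_inv hs)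
  -- The lower zigzag regroups as `a e a⁻¹` with the projection `e = (bb⁻¹)(c⁻¹c)(dd⁻¹)`, which is
  -- the range of `ae`.
  have hz : IsProjection (a * b * (c * b)⁻¹ * (c * d) * (a * d)⁻¹) := by
    have he : IsProjection (crst b * rst c * crst d) :=
      ((BirestrictionMonoid.isProjection_crst b).mul (BirestrictionMonoid.isProjection_rst c)).mul
        (BirestrictionMonoid.isProjection_crst d)
    have h2 : a * b * (c * b)⁻¹ * (c * d) * (a * d)⁻¹ =
        a * (crst b * rst c * crst d) * a⁻¹ := by
      simp only [crst_def, rst_def, mul_inv_rev, mul_assoc]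
    rw [h2, ← crst_mul_of_isProjection a he]
    exact BirestrictionMonoid.isProjection_crst _
  exact hS _ _ hz.isIdempotentElem ⟨f, hf.isIdempotentElem, h⟩

/-- An idempotent is its own range projection, so `zigzagRange` is the word `p q⁻¹ r s⁻¹` itself,
whose last factor absorbs `ss⁻¹`. -/
theorem zigzagRange_mul_crst {p q r s : S} (h : IsIdempotentElem (p * q⁻¹ * r * s⁻¹)) :
    zigzagRange p q r s * crst s = zigzagRange p q r s := by
  rw [zigzagRange_eq, crst_eq_self h, crst_def]
  simp only [mul_assoc]
  rw [← mul_assoc s⁻¹, inv_mul_inv]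

end InverseMonoid

/-- The obstruction uses only the birestriction signature, so it holds for the images in an
`E`-unitary inverse monoid and is pulled back along an injective morphism. -/
theorem not_admitsGeometricModel {Y : Type*} {S : Type*} [BirestrictionMonoid S] {ι : Y → S}
    {a b c d p q r s : Y} (hp : NatLE (ι a * ι b) (ι p)) (hq : NatLE (ι c * ι b) (ι q))
    (hr : NatLE (ι c * ι d) (ι r)) (hs : NatLE (ι a * ι d) (ι s))
    (h : zigzagRange (ι p) (ι q) (ι r) (ι s) * crst (ι s) ≠
      zigzagRange (ι p) (ι q) (ι r) (ι s)) :
    ¬ AdmitsGeometricModel.{v} ι := by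
  rintro ⟨U, _, κ, -, hU, f, -, hf⟩
  have key : ∀ {a b p : Y}, NatLE (ι a * ι b) (ι p) →
      NatLE (f.toFun (ι a) * f.toFun (ι b)) (f.toFun (ι p)) := fun h => by
    rw [← f.map_mul_toFun]; exact f.map_natLE h
  refine h (hf ?_)
  rw [f.map_mul_toFun, f.map_crst, f.map_zigzagRange]
  exact InverseMonoid.zigzagRange_mul_crst
    (InverseMonoid.isIdempotentElem_zigzag hU (key hp) (key hq) (key hr) (key hs))

/-! ### The inverse monoid of partial bijections -/

theorem PEquiv.trans_symm_trans_self {α β : Type*} (f : α ≃. β) :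
    f.trans (f.symm.trans f) = f := by
  refine PEquiv.ext fun a => Option.ext fun b => ?_
  rw [← Option.mem_def, PEquiv.mem_trans]
  constructor
  · rintro ⟨c, hc, h⟩
    obtain ⟨d, hd, hb⟩ := (PEquiv.mem_trans _ _ _ _).1 h
    rw [PEquiv.mem_iff_mem] at hd
    rwa [f.inj hc hd]
  · intro h
    exact ⟨b, h, (PEquiv.mem_trans _ _ _ _).2 ⟨a, (PEquiv.mem_iff_mem f).2 h, h⟩⟩

theorem PEquiv.mem_symm_trans_self {α β : Type*} (f : α ≃. β) (b c : β) :
    c ∈ f.symm.trans f b ↔ b = c ∧ ∃ a, b ∈ f a := by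
  rw [PEquiv.mem_trans]
  constructor
  · rintro ⟨a, hb, hc⟩
    rw [PEquiv.mem_iff_mem] at hb
    exact ⟨Option.some.inj (hb.symm.trans hc), a, hb⟩
  · rintro ⟨rfl, a, ha⟩
    exact ⟨a, (PEquiv.mem_iff_mem f).2 ha, ha⟩

/-- Both factors are partial identities, on the ranges of `f` and `g`; in either order they compose
to the identity on the intersection. -/
theorem PEquiv.symm_trans_self_comm {α β γ : Type*} (f : α ≃. β) (g : γ ≃. β) :
    (f.symm.trans f).trans (g.symm.trans g) = (g.symm.trans g).trans (f.symm.trans f) := by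
  refine PEquiv.ext fun b => Option.ext fun c => ?_
  simp only [← Option.mem_def, PEquiv.mem_trans _ _ b c, PEquiv.mem_symm_trans_self]
  constructor
  · rintro ⟨_, ⟨rfl, hf⟩, rfl, hg⟩
    exact ⟨_, ⟨rfl, hg⟩, rfl, hf⟩
  · rintro ⟨_, ⟨rfl, hf⟩, rfl, hg⟩
    exact ⟨_, ⟨rfl, hg⟩, rfl, hf⟩

/-- The symmetric inverse monoid on a set; partial bijections are composed from right to left. -/
def PartialBij (Z : Type u) : Type u := Z ≃. Z

namespace PartialBij

variable {Z : Type u}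

instance : InverseMonoid (PartialBij Z) where
  mul f g := PEquiv.trans g f
  one := PEquiv.refl Z
  inv f := PEquiv.symm f
  mul_assoc f g h := (PEquiv.trans_assoc h g f).symm
  one_mul f := PEquiv.trans_refl f
  mul_one f := PEquiv.refl_trans f
  inv_inv f := PEquiv.symm_symm f
  mul_inv_rev f g := PEquiv.symm_trans_rev g f
  mul_inv_mul f := PEquiv.trans_symm_trans_self f
  comm f g := PEquiv.symm_trans_self_comm g f

/-- The partial bijection with domain `{a}` and range `{b}`. -/
def single [DecidableEq Z] (a b : Z) : PartialBij Z := PEquiv.single a b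

/-- The empty partial bijection. -/
def empty : PartialBij Z := (⊥ : Z ≃. Z)

theorem empty_mul (f : PartialBij Z) : empty * f = empty := PEquiv.trans_bot f

theorem mul_empty (f : PartialBij Z) : f * empty = empty := PEquiv.bot_trans f

theorem inv_single [DecidableEq Z] (a b : Z) : (single a b)⁻¹ = single b a :=
  PEquiv.symm_single a b

theorem single_mul_single [DecidableEq Z] (a b c : Z) :
    single b c * single a b = single a c := PEquiv.single_trans_single a b c

theorem single_mul_single_of_ne [DecidableEq Z] {b b' : Z} (h : b ≠ b') (a c : Z) :
    single b c * single a b' = empty := PEquiv.single_trans_single_of_ne h.symm a c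

theorem single_ne_empty [DecidableEq Z] (a b : Z) : single a b ≠ empty := fun h => by
  have h' : PEquiv.single a b a = (⊥ : Z ≃. Z) a := congrArg (fun f : Z ≃. Z => f a) h
  simp at h'

end PartialBij

/-! ### Strong premorphisms and the monoids they define -/

/-- A strong premorphism from a monoid to a birestriction monoid. -/
structure StrongPremorphism (N : Type u) (M : Type v) [Monoid N] [BirestrictionMonoid M] where
  toFun : N → M
  map_one : toFun 1 = 1
  left : ∀ a b, toFun a * toFun b = crst (toFun a) * toFun (a * b)
  right : ∀ a b, toFun a * toFun b = toFun (a * b) * rst (toFun b)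

/-- The pairs `(a, f)` with `f ≤ φ a`. -/
def StrongPremorphism.Below {N : Type u} {M : Type v} [Monoid N] [BirestrictionMonoid M]
    (φ : StrongPremorphism N M) : Type (max u v) :=
  {p : N × M // NatLE p.2 (φ.toFun p.1)}

namespace StrongPremorphism

open BirestrictionMonoid in
instance instBR {N : Type u} {M : Type v} [Monoid N] [BirestrictionMonoid M]
    (φ : StrongPremorphism N M) : BirestrictionMonoid φ.Below where
  mul p q := ⟨(p.1.1 * q.1.1, p.1.2 * q.1.2), by
    obtain ⟨e, he, h⟩ := p.2.mul q.2
    -- Left strength gives `φ a · φ b = (φ a)^+ φ(ab)`, so the extra projection `(φ a)^+` brings the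
    -- product below `φ(ab)`.
    exact ⟨e * crst (φ.toFun p.1.1), he.mul (isProjection_crst _), by
      rw [mul_assoc, ← φ.left]; exact h⟩⟩
  one := ⟨(1, 1), by rw [φ.map_one]; exact NatLE.refl 1⟩
  rst p := ⟨(1, rst p.1.2), by rw [φ.map_one]; exact (isProjection_rst _).natLE_one⟩
  crst p := ⟨(1, crst p.1.2), by rw [φ.map_one]; exact (isProjection_crst _).natLE_one⟩
  mul_assoc p q r := Subtype.ext (Prod.ext (mul_assoc _ _ _) (mul_assoc _ _ _))
  one_mul p := Subtype.ext (Prod.ext (one_mul _) (one_mul _))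
  mul_one p := Subtype.ext (Prod.ext (mul_one _) (mul_one _))
  mul_rst p := Subtype.ext (Prod.ext (mul_one _) (mul_rst _))
  rst_comm p q := Subtype.ext (Prod.ext rfl (rst_comm _ _))
  rst_mul_rst p q := Subtype.ext (Prod.ext (one_mul _).symm (rst_mul_rst _ _))
  rst_mul p q := Subtype.ext (Prod.ext ((one_mul _).trans (mul_one _).symm) (rst_mul _ _))
  crst_mul p := Subtype.ext (Prod.ext (one_mul _) (crst_mul _))
  crst_comm p q := Subtype.ext (Prod.ext rfl (crst_comm _ _))
  crst_mul_crst p q := Subtype.ext (Prod.ext (one_mul _).symm (crst_mul_crst _ _))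
  mul_crst p q := Subtype.ext (Prod.ext ((mul_one _).trans (one_mul _).symm) (mul_crst _ _))
  rst_crst p := Subtype.ext (Prod.ext rfl (rst_crst _))
  crst_rst p := Subtype.ext (Prod.ext rfl (crst_rst _))

variable {N : Type u} {M : Type v} [Monoid N] [BirestrictionMonoid M]
  (φ : StrongPremorphism N M)

/-- The element `(a, φ a)`. -/
def top (a : N) : φ.Below := ⟨(a, φ.toFun a), BirestrictionMonoid.NatLE.refl _⟩

theorem natLE_top (p : φ.Below) : NatLE p (φ.top p.1.1) :=
  ⟨crst p, BirestrictionMonoid.isProjection_crst _,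
    Subtype.ext (Prod.ext (one_mul _).symm p.2.eq_crst_mul)⟩

/-- Projections have first coordinate `1`, so multiplying by one does not change the first
coordinate. -/
theorem fst_eq_of_sigma {p q : φ.Below} (h : Sigma p q) : p.1.1 = q.1.1 := by
  obtain ⟨e, ⟨s, rfl⟩, h⟩ := h
  have h' : 1 * p.1.1 = 1 * q.1.1 := congrArg (fun r : φ.Below => r.1.1) h
  simpa only [one_mul] using h'

instance instFBR : FBirestrictionMonoid φ.Below where
  mx p := φ.top p.1.1
  sigma_mx p := BirestrictionMonoid.sigma_of_natLE (φ.natLE_top p)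
  le_mx p q h := by rw [φ.fst_eq_of_sigma h]; exact φ.natLE_top q

theorem mx_eq (p : φ.Below) : mx p = φ.top p.1.1 := rfl

/-- On maximum elements `(a, φ a)` the strength identities are, in the second coordinate, the two
axioms of a strong premorphism. -/
theorem hasStrength (i : Strength) : HasStrength i φ.Below :=
  ⟨fun _ p q => Subtype.ext (Prod.ext (one_mul _).symm (φ.left p.1.1 q.1.1)),
    fun _ p q => Subtype.ext (Prod.ext (mul_one _).symm (φ.right p.1.1 q.1.1))⟩

/-- The second projection. -/
def snd : BRHom φ.Below M where
  toFun p := p.1.2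
  map_one' := rfl
  map_mul' _ _ := rfl
  map_rst _ := rfl
  map_crst _ := rfl

end StrongPremorphism

/-! ### A strong premorphism that separates -/

section Separating

open PartialBij (single empty)

variable {X : Type u}

open Classical in
/-- With `x` the given letter and `y` any other one, `xx`, `yx`, `yy`, `xy` are sent to `1 ↦ 4`,
`1 ↦ 3`, `0 ↦ 3`, `0 ↦ 2`; words whose length is not two are sent to the empty map. -/
noncomputable def sep (x : X) : FreeSemigroup X → PartialBij (Fin 5)
  | ⟨h, [t]⟩ => single (if t = x then 1 else 0) (if h = x then (if t = x then 4 else 2) else 3)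
  | _ => empty

/-- A word is stored as head and tail, so length two means a tail of length one. -/
theorem sep_of_length_ne (x : X) {u : FreeSemigroup X} (hu : u.tail.length ≠ 1) :
    sep x u = empty := by
  obtain ⟨h, _ | ⟨t, _ | ⟨t', l⟩⟩⟩ := u
  · rfl
  · simp at hu
  · rfl

/-- All domains lie in `{0, 1}` and all ranges in `{2, 3, 4}`, so no two of these maps can be
composed nontrivially. -/
theorem sep_mul_sep (x : X) (u v : FreeSemigroup X) : sep x u * sep x v = empty := by
  by_cases hu : u.tail.length = 1
  · by_cases hv : v.tail.length = 1
    · obtain ⟨h, l⟩ := u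
      obtain ⟨h', l'⟩ := v
      obtain ⟨t, rfl⟩ := List.length_eq_one_iff.1 hu
      obtain ⟨t', rfl⟩ := List.length_eq_one_iff.1 hv
      exact PartialBij.single_mul_single_of_ne (by split_ifs <;> decide) _ _
    · rw [sep_of_length_ne x hv, PartialBij.mul_empty]
  · rw [sep_of_length_ne x hu, PartialBij.empty_mul]

theorem crst_empty {Z : Type u} : crst (empty : PartialBij Z) = empty :=
  PartialBij.empty_mul _

theorem rst_empty {Z : Type u} : rst (empty : PartialBij Z) = empty :=
  PartialBij.mul_empty _

/-- The right-hand side is empty as well: if `u` has length two then `uv` is longer than two, and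
otherwise `sep x u` is already empty. The right-handed version argues with `v` instead. -/
theorem sep_left (x : X) (u v : FreeSemigroup X) :
    sep x u * sep x v = crst (sep x u) * sep x (u * v) := by
  rw [sep_mul_sep]
  by_cases hu : u.tail.length = 1
  · rw [sep_of_length_ne x (u := u * v) (by simp [hu]), PartialBij.mul_empty]
  · rw [sep_of_length_ne x hu, crst_empty, PartialBij.empty_mul]

theorem sep_right (x : X) (u v : FreeSemigroup X) :
    sep x u * sep x v = sep x (u * v) * rst (sep x v) := by
  rw [sep_mul_sep]
  by_cases hv : v.tail.length = 1
  · rw [sep_of_length_ne x (u := u * v) (by simp [hv]), PartialBij.empty_mul]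
  · rw [sep_of_length_ne x hv, rst_empty, PartialBij.mul_empty]

/-- The map `sep`, extended to the free monoid. -/
noncomputable def sepPremorphism (x : X) :
    StrongPremorphism (WithOne (FreeSemigroup X)) (PartialBij (Fin 5)) where
  toFun a := WithOne.recOneCoe 1 (sep x) a
  map_one := rfl
  left a b := by
    induction a using WithOne.recOneCoe with
    | one => simp [BirestrictionMonoid.crst_one]
    | coe u =>
      induction b using WithOne.recOneCoe with
      | one => simp [BirestrictionMonoid.crst_mul]
      | coe v => exact sep_left x u v
  right a b := by
    induction b using WithOne.recOneCoe with
    | one => simp [BirestrictionMonoid.rst_one]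
    | coe v =>
      induction a using WithOne.recOneCoe with
      | one => simp [BirestrictionMonoid.mul_rst]
      | coe u => exact sep_right x u v

/-- The map `sep`, extended to the generators `X ∪ X̄⁺`. -/
noncomputable def sepGen (x : X) : ExtGen X → PartialBij (Fin 5) :=
  Sum.elim (fun _ => empty) (sep x)

theorem sep_xx (x : X) : sep x (.of x * .of x) = single 1 4 := by
  change single _ _ = _
  simp

theorem sep_yx {x y : X} (h : y ≠ x) : sep x (.of y * .of x) = single 1 3 := by
  change single _ _ = _
  simp [h]

theorem sep_yy {x y : X} (h : y ≠ x) : sep x (.of y * .of y) = single 0 3 := by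
  change single _ _ = _
  simp [h]

theorem sep_xy {x y : X} (h : y ≠ x) : sep x (.of x * .of y) = single 0 2 := by
  change single _ _ = _
  simp [h]

/-- Read from right to left, the factors trace `2 ↦ 0 ↦ 3 ↦ 1 ↦ 4`. -/
theorem sep_zigzag {x y : X} (h : y ≠ x) :
    sep x (.of x * .of x) * (sep x (.of y * .of x))⁻¹ * sep x (.of y * .of y) *
      (sep x (.of x * .of y))⁻¹ = single 2 4 := by
  simp only [sep_xx, sep_yx h, sep_yy h, sep_xy h, PartialBij.inv_single,
    PartialBij.single_mul_single]

/-- The zigzag has range `{4}` while the last map has range `{2}`; the product of these partial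
identities is empty. -/
theorem sep_zigzagRange_ne {x y : X} (h : y ≠ x) :
    zigzagRange (sep x (.of x * .of x)) (sep x (.of y * .of x)) (sep x (.of y * .of y))
        (sep x (.of x * .of y)) * crst (sep x (.of x * .of y)) ≠
      zigzagRange (sep x (.of x * .of x)) (sep x (.of y * .of x)) (sep x (.of y * .of y))
        (sep x (.of x * .of y)) := by
  rw [InverseMonoid.zigzagRange_eq, sep_zigzag h, sep_xy h]
  simp only [InverseMonoid.crst_def, PartialBij.inv_single, PartialBij.single_mul_single]
  rw [PartialBij.single_mul_single_of_ne (by decide)]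
  exact (PartialBij.single_ne_empty _ _).symm

end Separating

/-! ### The relations -/

/-- The value of `FreeBR.lift` satisfies the relations `N_i` if the assignment map is strong. -/
theorem lift_eq_of_mem_relOf {X : Type u} {M : Type v} [BirestrictionMonoid M]
    (κ : ExtGen X → M)
    (hX : ∀ x, κ (.inl x) = κ (.inr (FreeSemigroup.of x)) * rst (κ (.inl x)))
    (hl : ∀ u v, κ (.inr u) * κ (.inr v) = crst (κ (.inr u)) * κ (.inr (u * v)))
    (hr : ∀ u v, κ (.inr u) * κ (.inr v) = κ (.inr (u * v)) * rst (κ (.inr v)))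
    (i : Strength) {a b : FreeBR (ExtGen X)} (h : (a, b) ∈ relOf X i) :
    (FreeBR.lift κ).toFun a = (FreeBR.lift κ).toFun b := by
  -- Either strong relation implies the plain one, which only says that `ū v̄` lies below the bar of
  -- `uv`.
  have hN : ∀ u v, κ (.inr u) * κ (.inr v) =
      κ (.inr (u * v)) * rst (κ (.inr u) * κ (.inr v)) := fun u v =>
    BirestrictionMonoid.NatLE.eq_mul_rst
      (BirestrictionMonoid.natLE_of_eq_mul_rst (y := κ (.inr v)) (hr u v))
  have key : (a, b) ∈ relN X ∨ (a, b) ∈ relNls X ∨ (a, b) ∈ relNrs X := by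
    cases i
    · exact .inl h
    · exact .inr (.inl h)
    · exact .inr (.inr h)
    · exact .inr h
  rcases key with (⟨x, h⟩ | ⟨u, v, h⟩) | (⟨x, h⟩ | ⟨u, v, h⟩) | (⟨x, h⟩ | ⟨u, v, h⟩) <;>
    obtain ⟨rfl, rfl⟩ := Prod.mk.inj h
  exacts [hX x, hN u v, hX x, hl u v, hX x, hr u v]

/-- This inequality is the common consequence of the four sets of relations, and all that the zigzag
argument needs from them. -/
theorem natLE_mul_of_mem_relOf {X : Type u} {M : Type v} [BirestrictionMonoid M]
    (f : BRHom (FreeBR (ExtGen X)) M) (i : Strength)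
    (h : ∀ a b, (a, b) ∈ relOf X i → f.toFun a = f.toFun b) (u v : FreeSemigroup X) :
    NatLE (f.toFun (genBar u) * f.toFun (genBar v)) (f.toFun (genBar (u * v))) := by
  have hr : ∀ {z}, (genBar u * genBar v, genBar (u * v) * rst z) ∈ relOf X i →
      NatLE (f.toFun (genBar u) * f.toFun (genBar v)) (f.toFun (genBar (u * v))) := fun hz => by
    have := h _ _ hz
    rw [f.map_mul_toFun, f.map_mul_toFun, f.map_rst] at this
    exact BirestrictionMonoid.natLE_of_eq_mul_rst this
  have hl : (genBar u * genBar v, crst (genBar u) * genBar (u * v)) ∈ relOf X i →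
      NatLE (f.toFun (genBar u) * f.toFun (genBar v)) (f.toFun (genBar (u * v))) := fun hz => by
    have := h _ _ hz
    rw [f.map_mul_toFun, f.map_mul_toFun, f.map_crst] at this
    exact ⟨_, BirestrictionMonoid.isProjection_crst _, this⟩
  cases i
  · exact hr (.inr ⟨u, v, rfl⟩)
  · exact hl (.inr ⟨u, v, rfl⟩)
  · exact hr (.inr ⟨u, v, rfl⟩)
  · exact hl (.inl (.inr ⟨u, v, rfl⟩))

theorem lift_sepGen_eq {X : Type u} (x : X) (i : Strength) {a b : FreeBR (ExtGen X)}
    (h : (a, b) ∈ relOf X i) :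
    (FreeBR.lift (sepGen x)).toFun a = (FreeBR.lift (sepGen x)).toFun b :=
  lift_eq_of_mem_relOf (sepGen x)
    -- The letters of `X` go to the empty map, so `x = x̄ x^*` becomes `empty = sep x _ * empty`.
    (fun _ => ((congrArg _ rst_empty).trans (PartialBij.mul_empty _)).symm)
    (sep_left x) (sep_right x) i h

/-! ### Morphisms from presented monoids -/

theorem BRCon.map_eq {S : Type u} {T : Type v} [BirestrictionMonoid S] [BirestrictionMonoid T]
    {R : Set (S × S)} (f : BRHom S T) (hf : ∀ a b, (a, b) ∈ R → f.toFun a = f.toFun b)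
    {a b : S} (h : BRCon R a b) : f.toFun a = f.toFun b := by
  induction h with
  | of h => exact hf _ _ h
  | refl => rfl
  | symm _ ih => exact ih.symm
  | trans _ _ ih ih' => exact ih.trans ih'
  | mul _ _ ih ih' => rw [f.map_mul_toFun, f.map_mul_toFun, ih, ih']
  | rst _ ih => rw [f.map_rst, f.map_rst, ih]
  | crst _ ih => rw [f.map_crst, f.map_crst, ih]

/-- The morphism induced on a presented birestriction monoid. -/
def BRPresented.lift {Y : Type u} {T : Type v} [BirestrictionMonoid T]
    {R : Set (FreeBR Y × FreeBR Y)} (f : BRHom (FreeBR Y) T)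
    (hf : ∀ a b, (a, b) ∈ R → f.toFun a = f.toFun b) : BRHom (BRPresented R) T where
  toFun := Quotient.lift f.toFun fun _ _ h => BRCon.map_eq f hf h
  map_one' := f.map_one'
  map_mul' := by rintro ⟨a⟩ ⟨b⟩; exact f.map_mul_toFun a b
  map_rst := by rintro ⟨a⟩; exact f.map_rst a
  map_crst := by rintro ⟨a⟩; exact f.map_crst a

/-- The canonical morphism onto a presented birestriction monoid. -/
def BRPresented.mk {Y : Type u} (R : Set (FreeBR Y × FreeBR Y)) :
    BRHom (FreeBR Y) (BRPresented R) where
  toFun := Quotient.mk _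
  map_one' := rfl
  map_mul' _ _ := rfl
  map_rst _ := rfl
  map_crst _ := rfl

/-- The value of a term under an assignment of the variables. -/
def InvTerm.eval {Y : Type u} {S : Type v} [InverseMonoid S] (f : Y → S) : InvTerm Y → S
  | of y => f y
  | one => 1
  | mul a b => eval f a * eval f b
  | inv a => (eval f a)⁻¹

theorem InvTerm.eval_eq {Y : Type u} {S : Type v} [InverseMonoid S] (f : Y → S)
    {a b : InvTerm Y} (h : Rel a b) : eval f a = eval f b := by
  induction h with
  | refl => rfl
  | symm _ ih => exact ih.symm
  | trans _ _ ih ih' => exact ih.trans ih'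
  | mul _ _ ih ih' => simp only [eval, ih, ih']
  | inv _ ih => simp only [eval, ih]
  | mul_assoc => exact _root_.mul_assoc _ _ _
  | one_mul => exact _root_.one_mul _
  | mul_one => exact _root_.mul_one _
  | inv_inv => exact InverseMonoid.inv_inv _
  | mul_inv_rev => exact InverseMonoid.mul_inv_rev _ _
  | mul_inv_mul => exact InverseMonoid.mul_inv_mul _
  | comm => exact InverseMonoid.comm _ _

/-- The morphism from `FI(Y)` that extends an assignment map. -/
def FreeInv.lift {Y : Type u} {S : Type v} [InverseMonoid S] (f : Y → S) : FreeInv Y → S :=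
  Quotient.lift (InvTerm.eval f) fun _ _ h => InvTerm.eval_eq f h

theorem FreeInv.lift_mul {Y : Type u} {S : Type v} [InverseMonoid S] (f : Y → S)
    (a b : FreeInv Y) : lift f (a * b) = lift f a * lift f b := by
  obtain ⟨a⟩ := a; obtain ⟨b⟩ := b; rfl

theorem FreeInv.lift_inv {Y : Type u} {S : Type v} [InverseMonoid S] (f : Y → S)
    (a : FreeInv Y) : lift f a⁻¹ = (lift f a)⁻¹ := by
  obtain ⟨a⟩ := a; rfl

/-- Thanks to this, relations checked for birestriction terms need not be checked again for their
images in the free inverse monoid. -/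
theorem FreeInv.lift_psi {Y : Type u} {S : Type v} [InverseMonoid S] (f : Y → S)
    (a : FreeBR Y) : lift f ((psi Y).toFun a) = (FreeBR.lift f).toFun a := by
  obtain ⟨a⟩ := a
  change lift f (BRTerm.eval FreeInv.of a) = BRTerm.eval f a
  induction a with
  | of y => rfl
  | one => rfl
  | mul a b iha ihb => simp only [BRTerm.eval, lift_mul, iha, ihb]
  | rst a ih => simp only [BRTerm.eval, InverseMonoid.rst_def, lift_mul, lift_inv, ih]
  | crst a ih => simp only [BRTerm.eval, InverseMonoid.crst_def, lift_mul, lift_inv, ih]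

theorem InvCon.lift_eq {Y : Type u} {S : Type v} [InverseMonoid S] (f : Y → S)
    {R : Set (FreeInv Y × FreeInv Y)}
    (hf : ∀ a b, (a, b) ∈ R → FreeInv.lift f a = FreeInv.lift f b)
    {a b : FreeInv Y} (h : InvCon R a b) : FreeInv.lift f a = FreeInv.lift f b := by
  induction h with
  | of h => exact hf _ _ h
  | refl => rfl
  | symm _ ih => exact ih.symm
  | trans _ _ ih ih' => exact ih.trans ih'
  | mul _ _ ih ih' => rw [FreeInv.lift_mul, FreeInv.lift_mul, ih, ih']
  | inv _ ih => rw [FreeInv.lift_inv, FreeInv.lift_inv, ih]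

/-- The canonical morphism from `FBR(Y)` to the universal inverse monoid of `BRestr⟨Y | R⟩`. -/
def UniversalInverse.mk {Y : Type u} (R : Set (FreeBR Y × FreeBR Y)) :
    BRHom (FreeBR Y) (UniversalInverse R) where
  toFun a := Quotient.mk _ ((psi Y).toFun a)
  map_one' := rfl
  map_mul' a b := congrArg (Quotient.mk _) ((psi Y).map_mul_toFun a b)
  map_rst a := congrArg (Quotient.mk _) ((psi Y).map_rst a)
  map_crst a := congrArg (Quotient.mk _) ((psi Y).map_crst a)

theorem UniversalInverse.mk_eq {Y : Type u} {R : Set (FreeBR Y × FreeBR Y)} (a b : FreeBR Y)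
    (h : (a, b) ∈ R) : (mk R).toFun a = (mk R).toFun b :=
  Quotient.sound (InvCon.of ⟨_, h, rfl⟩)

/-! ### The main theorem -/

/-- From `a ≤ mx a` and `b ≤ mx b` the product `ab` lies below `mx a * mx b`, so the two are
`σ`-related. -/
theorem FBirestrictionMonoid.natLE_mx_mul {S : Type u} [FBirestrictionMonoid S] (a b : S) :
    NatLE (mx a * mx b) (mx (a * b)) := by
  have h : ∀ c : S, NatLE c (mx c) := fun c => le_mx c c (.refl c)
  exact le_mx _ _ (BirestrictionMonoid.sigma_of_natLE ((h a).mul (h b)))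

theorem not_admitsGeometricModel_of_sep {X : Type*} {S : Type*} [BirestrictionMonoid S]
    {ι : ExtGen X → S}
    (hι : ∀ u v, NatLE (ι (.inr u) * ι (.inr v)) (ι (.inr (u * v)))) {x y : X} (hxy : y ≠ x)
    (g : BRHom S (PartialBij (Fin 5))) (hg : ∀ u, g.toFun (ι (.inr u)) = sep x u) :
    ¬ AdmitsGeometricModel.{v} ι := by
  -- The choice is `a = b = x̄`, `c = d = ȳ`.
  refine not_admitsGeometricModel (hι (.of x) (.of x)) (hι (.of y) (.of x)) (hι (.of y) (.of y))
    (hι (.of x) (.of y)) fun h => sep_zigzagRange_ne hxy ?_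
  have h' := congrArg g.toFun h
  simpa only [g.map_mul_toFun, g.map_crst, g.map_zigzagRange, hg] using h'

theorem not_admitsGeometricModel_calF {X : Type u} {x y : X} (hxy : y ≠ x) (i : Strength) :
    ¬ AdmitsGeometricModel.{v} (CalF.gen i X) :=
  not_admitsGeometricModel_of_sep
    (natLE_mul_of_mem_relOf (BRPresented.mk (relOf X i)) i
      fun _ _ h => Quotient.sound (BRCon.of h)) hxy
    (BRPresented.lift (FreeBR.lift (sepGen x)) fun _ _ h => lift_sepGen_eq x i h) fun _ => rfl

theorem not_admitsGeometricModel_freeFBR {X : Type u} {x y : X} (hxy : y ≠ x) (i : Strength) :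
    ¬ AdmitsGeometricModel.{v} (FreeFBR.gen i X) := by
  let φ := sepPremorphism x
  -- A letter `z` goes to the pair `(z, empty)`. The second coordinate carries no information yet,
  -- but the first one records the word, and `mx` then recovers `sep` of that word.
  obtain ⟨g, hg, -⟩ := FreeFBR.existsUnique_lift (φ.hasStrength i)
    fun z => φ.top (FreeSemigroup.of z : FreeSemigroup X)
  have hfst : ∀ u : FreeSemigroup X,
      (g.toFun (FreeSemigroup.lift (FreeFBR.of : X → FreeFBR i X) u)).1.1 = u := fun u => by
    induction u using FreeSemigroup.recOnMul with
    | ih1 z => rw [FreeSemigroup.lift_of, hg]; rfl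
    | ih2 z w hz hw =>
      rw [map_mul, g.toBRHom.map_mul_toFun, WithOne.coe_mul, ← hz, ← hw]; rfl
  refine not_admitsGeometricModel_of_sep (fun u v => ?_) hxy
    { toMonoidHom := φ.snd.toMonoidHom.comp g.toMonoidHom
      map_rst := fun a => congrArg φ.snd.toFun (g.map_rst a)
      map_crst := fun a => congrArg φ.snd.toFun (g.map_crst a) } fun u => ?_
  · simp only [FreeFBR.gen, map_mul]
    exact FBirestrictionMonoid.natLE_mx_mul _ _
  · change (g.toFun (mx (FreeSemigroup.lift FreeFBR.of u))).1.2 = sep x u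
    rw [g.map_mx, φ.mx_eq, hfst]
    rfl

theorem not_isEUnitary_calI {X : Type u} {x y : X} (hxy : y ≠ x) (i : Strength) :
    ¬ IsEUnitary (CalI i X) := by
  intro hU
  have hN := natLE_mul_of_mem_relOf (UniversalInverse.mk (relOf X i)) i UniversalInverse.mk_eq
  have ht := InverseMonoid.isIdempotentElem_zigzag hU (hN (.of x) (.of x)) (hN (.of y) (.of x))
    (hN (.of y) (.of y)) (hN (.of x) (.of y))
  let g : CalI i X → PartialBij (Fin 5) := Quotient.lift (FreeInv.lift (sepGen x)) fun _ _ h =>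
    InvCon.lift_eq (sepGen x) (by
      rintro _ _ ⟨⟨a, b⟩, h, hab⟩
      obtain ⟨rfl, rfl⟩ := Prod.mk.inj hab
      rw [FreeInv.lift_psi, FreeInv.lift_psi]
      exact lift_sepGen_eq x i h) h
  -- The image under `g` of the idempotent zigzag is `2 ↦ 4`, whose square is empty.
  have h' : IsIdempotentElem (sep x (.of x * .of x) * (sep x (.of y * .of x))⁻¹ *
      sep x (.of y * .of y) * (sep x (.of x * .of y))⁻¹) := congrArg g ht.eq
  rw [sep_zigzag hxy] at h'
  have h'' := h'.eq
  rw [PartialBij.single_mul_single_of_ne (by decide)] at h''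
  exact PartialBij.single_ne_empty _ _ h''.symm

theorem mainTheorem6 {X : Type u} [Nontrivial X] (i : Strength) :
    ¬ AdmitsGeometricModel.{v} (CalF.gen i X) ∧
    ¬ AdmitsGeometricModel.{v} (FreeFBR.gen i X) ∧
    ¬ IsEUnitary (CalI i X) := by
  obtain ⟨x, y, hxy⟩ := exists_pair_ne X
  exact ⟨not_admitsGeometricModel_calF hxy.symm i, not_admitsGeometricModel_freeFBR hxy.symm i,
    not_isEUnitary_calI hxy.symm i⟩
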